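/- A Markov decision process (MDP) consists of a countable set $S$ of states, partitioned into player states $S_\Box$ and random states $S_\bigcirc$, a transition relation $\longrightarrow\,\subseteq S\times S$ in which every state has at least one (possibly infinitely many) successors, and, for every random state $s$, a probability distribution $P(s)$ on the successors of $s$. A strategy $\sigma$ maps every finite sequence $s_0\cdots s_n\in S^*S_\Box$ ending in a player state to a probability distribution on the successors of $s_n$. It is memoryless deterministic (MD) if this distribution is always a Dirac distribution and depends only on $s_n$. Together with an initial state $s$, a strategy $\sigma$ induces the usual probability measure $\mathcal P_{\mathcal M,s,\sigma}$ on infinite sequences of states starting in $s$. A Büchi objective is given by a color function $\mathit{Col}:S\to\{1,2\}$: the set $\varphi$ of all infinite sequences in which the largest color occurring infinitely often is even (that is, color $2$ occurs infinitely often). The value of $s$ is $\mathrm{val}_{\mathcal M}(s)=\sup_{\sigma}\mathcal P_{\mathcal M,s,\sigma}(\varphi)$, the supremum being over all strategies, and $\sigma$ is optimal from $s$ if $\mathcal P_{\mathcal M,s,\sigma}(\varphi)=\mathrm{val}_{\mathcal M}(s)$. Theorem. Let $\mathcal M$ be a countable MDP, finitely or infinitely branching, and let $\varphi$ be a Büchi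 objective. Then there exists an MD-strategy $\sigma'$ that is optimal from all states that have an optimal strategy: for every $s\in S$, $$\bigl(\exists\,\sigma.\ \mathcal P_{\mathcal M,s,\sigma}(\varphi)=\mathrm{val}_{\mathcal M}(s)\bigr)\ \Longrightarrow\ \mathcal P_{\mathcal M,s,\sigma'}(\varphi)=\mathrm{val}_{\mathcal M}(s).$$ -/

import Mathlib

open MeasureTheory ProbabilityTheory Filter

noncomputable section

/-- A Markov decision process with state set `S`. The states in `player` belong to the player,
all other states are random states. Every state has a successor, and every random state carries
a probability distribution over its successors. Infinite branching is allowed. -/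
structure MDP (S : Type*) where
  player : Set S
  trans : S → S → Prop
  exists_trans : ∀ s, ∃ t, trans s t
  prob : {s : S // s ∉ player} → PMF S
  trans_of_mem_support : ∀ s : {s : S // s ∉ player}, ∀ t ∈ (prob s).support, trans s t

namespace MDP

variable {S : Type*}

/-- A (history-dependent, randomized) strategy: to a finite sequence of states `h`
(in chronological order) followed by a current player state `s`, it assigns a probability
distribution over the successors of `s`. -/
structure Strategy (M : MDP S) where
  act : List S → {s : S // s ∈ M.player} → PMF S
  trans_of_mem_support : ∀ (h : List S) (s : {s : S // s ∈ M.player}),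
    ∀ t ∈ (act h s).support, M.trans s t

namespace Strategy

variable {M : MDP S}

/-- The choice depends on the current state only. -/
def IsMemoryless (σ : M.Strategy) : Prop :=
  ∀ (h h' : List S) (s : {s : S // s ∈ M.player}), σ.act h s = σ.act h' s

/-- All chosen distributions are Dirac distributions. -/
def IsDeterministic (σ : M.Strategy) : Prop :=
  ∀ (h : List S) (s : {s : S // s ∈ M.player}), ∃ t : S, σ.act h s = PMF.pure t

/-- Memoryless deterministic strategies. -/
def IsMD (σ : M.Strategy) : Prop :=
  σ.IsMemoryless ∧ σ.IsDeterministic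

open Classical in
/-- The distribution of the next state after the history `h` followed by the current state `s`:
given by the strategy in player states, and by the MDP in random states. -/
def step (σ : M.Strategy) (h : List S) (s : S) : PMF S :=
  if hs : s ∈ M.player then σ.act h ⟨s, hs⟩ else M.prob ⟨s, hs⟩

variable [Countable S] [MeasurableSpace S] [DiscreteMeasurableSpace S]

/-- The transition kernel from partial plays `x 0, …, x n` to the next state. -/
def stepKernel (σ : M.Strategy) (n : ℕ) : Kernel (Finset.Iic n → S) S where
  toFun x := (σ.step (List.ofFn fun i : Fin n => x ⟨i, Finset.mem_Iic.2 i.2.le⟩)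
    (x ⟨n, Finset.mem_Iic.2 le_rfl⟩)).toMeasure
  measurable' := measurable_of_countable _

instance (σ : M.Strategy) (n : ℕ) : IsMarkovKernel (σ.stepKernel n) :=
  ⟨fun x => by unfold stepKernel; exact PMF.toMeasure.isProbabilityMeasure _⟩

/-- The probability measure on infinite sequences of states induced by the strategy `σ` and the
initial state `s₀`, given by the Ionescu-Tulcea theorem. -/
def playMeasure (σ : M.Strategy) (s₀ : S) : Measure (ℕ → S) :=
  Kernel.traj (X := fun _ => S) (fun n => σ.stepKernel n) 0 (fun _ => s₀)

end Strategy

variable [Countable S] [MeasurableSpace S] [DiscreteMeasurableSpace S]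

/-- The value of the state `s`: the supremum over all strategies of the probability of achieving
the objective `φ` from `s`. -/
def value (M : MDP S) (φ : Set (ℕ → S)) (s : S) : ENNReal :=
  ⨆ σ : M.Strategy, σ.playMeasure s φ

/-- The strategy `σ` is optimal for the objective `φ` from the initial state `s`. -/
def Strategy.IsOptimal {M : MDP S} (σ : M.Strategy) (φ : Set (ℕ → S)) (s : S) : Prop :=
  M.value φ s ≤ σ.playMeasure s φ

end MDP

/-- The parity objective of a color function: some even color occurs infinitely often and
eventually no larger color occurs, i.e. the largest color occurring infinitely often is even. -/
def parityObjective {S : Type*} (col : S → ℕ) : Set (ℕ → S) :=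
  {w | ∃ k : ℕ, Even k ∧ (∃ᶠ n in atTop, col (w n) = k) ∧ ∀ᶠ n in atTop, col (w n) ≤ k}

/-- A Büchi color function uses only the colors 1 and 2; the Büchi objectives are the parity
objectives of such color functions. -/
def IsBuchiColoring {S : Type*} (col : S → ℕ) : Prop :=
  ∀ s, col s ∈ ({1, 2} : Set ℕ)

end

/-! ### Weighted reachability: near-optimal positional choices from one state -/

noncomputable section

namespace WeightedReach

open scoped ENNReal

variable {S : Type*} {F : Set S} {v : S → ℝ≥0∞}

/-! Let `F` be the set of states of color 2. The Büchi value is superharmonic, so an optimal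
strategy can afford no loss: every state it moves to again has an optimal strategy, and its moves in
player states keep the value. Discard all other moves (`optKernels`), and let the weight `v`
(`optWeight`) be the value on states with an optimal strategy and 0 elsewhere. Then `v` is harmonic
for every remaining choice.

This reduces Büchi to reachability, where `v` is collected at the first visit to `F` at a time at
least 1. Büchi forces such a visit, and the success probability after it is at most the weight found
there, so the optimal reward is at least `v` (`optWeight_le_reachVal`). Conversely, let a positional
choice collect `v` from every state. Since `v` is at most 1, it visits `F` at a time at least 1 with
probability at least `v`; harmonicity shifts this to times at least `k`, for every `k`, and the
limit in `k` is Büchi (`optWeight_le_playMeasure_positional`).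

To find this choice, states are treated one after another: `exists_restriction` fixes part of the
choice at a small multiplicative loss, and the losses multiply to at least one half
(`exists_choice_half`). Harmonicity then turns half of `v` into all of `v`
(`weight_le_reachVal_of_half`). -/

open Classical in
/-- The one-step value of the kernel `a` if reaching a state `t ∈ F` pays `v t` and reaching any
other state `t` is worth `f t`. -/
def back (F : Set S) (v : S → ℝ≥0∞) (a f : S → ℝ≥0∞) : ℝ≥0∞ :=
  ∑' t, a t * (if t ∈ F then v t else f t)

/-- The optimal expected weight of the first state visited in `F`, within `n` steps, when in each
state `s` one of the kernels in `A s` can be chosen. -/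
def iter (F : Set S) (v : S → ℝ≥0∞) (A : S → Set (S → ℝ≥0∞)) : ℕ → S → ℝ≥0∞
  | 0 => 0
  | n + 1 => fun s => ⨆ a ∈ A s, back F v a (iter F v A n)

/-- The optimal expected weight of the first state visited in `F`. -/
def reachVal (F : Set S) (v : S → ℝ≥0∞) (A : S → Set (S → ℝ≥0∞)) (s : S) : ℝ≥0∞ :=
  ⨆ n, iter F v A n s

theorem back_mono {a f g : S → ℝ≥0∞} (h : f ≤ g) : back F v a f ≤ back F v a g := by
  refine ENNReal.tsum_le_tsum fun t => ?_
  gcongr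
  split_ifs
  exacts [le_rfl, h t]

theorem back_add_le (a f h : S → ℝ≥0∞) :
    back F v a (fun t => f t + h t) ≤ back F v a f + ∑' t, a t * h t := by
  rw [back, back, ← ENNReal.tsum_add]
  refine ENNReal.tsum_le_tsum fun t => ?_
  rw [← mul_add]
  gcongr
  split_ifs
  exacts [le_self_add, le_rfl]

theorem back_smul (m : ℝ≥0∞) (a f : S → ℝ≥0∞) : back F v (m • a) f = m * back F v a f := by
  simp only [back, Pi.smul_apply, smul_eq_mul, mul_assoc, ENNReal.tsum_mul_left]

theorem mul_back_le {m : ℝ≥0∞} (hm : m ≤ 1) (a f : S → ℝ≥0∞) :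
    m * back F v a f ≤ back F v a (fun t => m * f t) := by
  rw [back, ← ENNReal.tsum_mul_left]
  refine ENNReal.tsum_le_tsum fun t => ?_
  rw [mul_left_comm]
  gcongr
  split_ifs
  exacts [mul_le_of_le_one_left' hm, le_rfl]

theorem back_convex {p q : ℝ≥0∞} (hpq : p + q = 1) (a f g : S → ℝ≥0∞) :
    back F v a (fun t => p * f t + q * g t) = p * back F v a f + q * back F v a g := by
  rw [back, back, back, ← ENNReal.tsum_mul_left, ← ENNReal.tsum_mul_left, ← ENNReal.tsum_add]
  refine tsum_congr fun t => ?_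
  split_ifs
  · rw [mul_left_comm p, mul_left_comm q, ← mul_add, ← add_mul, hpq, one_mul]
  · ring

theorem back_iSup (a : S → ℝ≥0∞) {f : ℕ → S → ℝ≥0∞} (hf : Monotone f) :
    back F v a (fun t => ⨆ n, f n t) = ⨆ n, back F v a (f n) := by
  let _ : MeasurableSpace S := ⊤
  simp only [back, ← lintegral_count]
  rw [← lintegral_iSup (fun n => measurable_from_top)]
  · refine lintegral_congr fun t => ?_
    split_ifs
    · rw [ciSup_const]
    · rw [ENNReal.mul_iSup]
  · intro m n hmn t
    dsimp only
    split_ifs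
    · exact le_rfl
    · exact mul_le_mul_right (hf hmn t) _

variable {A : S → Set (S → ℝ≥0∞)}

theorem iter_mono : Monotone (iter F v A) := by
  refine monotone_nat_of_le_succ fun n => ?_
  induction n with
  | zero => exact fun s => zero_le
  | succ n ih =>
    intro s
    exact iSup₂_mono fun a _ => back_mono ih

theorem reachVal_eq (s : S) :
    reachVal F v A s = ⨆ a ∈ A s, back F v a (reachVal F v A) := by
  have h : reachVal F v A = fun t => ⨆ n, iter F v A n t := rfl
  rw [h]
  simp only [back_iSup _ iter_mono]
  refine le_antisymm (iSup_le fun n => ?_) (iSup₂_le fun a ha => iSup_le fun n => ?_)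
  · cases n with
    | zero => exact zero_le
    | succ n =>
      exact iSup₂_le fun a ha => le_iSup₂_of_le a ha (le_iSup (fun n => back F v a _) n)
  · exact le_iSup_of_le (n + 1) (le_iSup₂_of_le a ha le_rfl)

theorem back_le_reachVal {s : S} {a : S → ℝ≥0∞} (ha : a ∈ A s) :
    back F v a (reachVal F v A) ≤ reachVal F v A s := by
  rw [reachVal_eq s]
  exact le_iSup₂_of_le a ha le_rfl

theorem reachVal_le {f : S → ℝ≥0∞} (h : ∀ s, ∀ a ∈ A s, back F v a f ≤ f s) :
    reachVal F v A ≤ f := by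
  refine fun s => iSup_le fun n => ?_
  suffices iter F v A n ≤ f from this s
  induction n with
  | zero => exact fun s => zero_le
  | succ n ih => exact fun s => iSup₂_le fun a ha => (back_mono ih).trans (h s a ha)

theorem reachVal_mono {B : S → Set (S → ℝ≥0∞)} (h : ∀ s, A s ⊆ B s) :
    reachVal F v A ≤ reachVal F v B :=
  reachVal_le fun _ _ ha => back_le_reachVal (h _ ha)

theorem reachVal_singleton (c : S → S → ℝ≥0∞) (s : S) :
    reachVal F v (fun s => {c s}) s = back F v (c s) (reachVal F v fun s => {c s}) := by
  conv_lhs => rw [reachVal_eq]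
  simp

theorem back_weight (a : S → ℝ≥0∞) : back F v a v = ∑' t, a t * v t := by
  simp [back]

theorem reachVal_le_weight (hv : ∀ s, ∀ a ∈ A s, ∑' t, a t * v t ≤ v s) : reachVal F v A ≤ v :=
  reachVal_le fun s a ha => (back_weight a).trans_le (hv s a ha)

theorem exists_mul_iSup_le {ι : Type*} [Nonempty ι] (f : ι → ℝ≥0∞) (hf : ⨆ i, f i ≠ ⊤) {m : ℝ≥0∞}
    (hm : m < 1) : ∃ i, m * ⨆ i, f i ≤ f i := by
  by_cases h0 : ⨆ i, f i = 0
  · exact ⟨Classical.arbitrary ι, by simp [h0]⟩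
  · have : m * ⨆ i, f i < ⨆ i, f i := by
      conv_rhs => rw [← one_mul (⨆ i, f i)]
      exact ENNReal.mul_lt_mul_left h0 hf hm
    obtain ⟨i, hi⟩ := lt_iSup_iff.1 this
    exact ⟨i, hi.le⟩

/-- A positional choice that is at least as good as the value discounted by the factor `m ^ 2`. -/
theorem exists_choice_ge_discounted (hA : ∀ s, (A s).Nonempty)
    (hv : ∀ s, ∀ a ∈ A s, ∑' t, a t * v t ≤ v s) (hv1 : ∀ s, v s ≠ ⊤) {m : ℝ≥0∞} (hm : m < 1) :
    ∃ c : S → S → ℝ≥0∞, (∀ s, c s ∈ A s) ∧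
      reachVal F v (fun s => (fun a => (m * m) • a) '' A s) ≤ reachVal F v fun s => {c s} := by
  set B : S → Set (S → ℝ≥0∞) := fun s => (fun a => (m * m) • a) '' A s with hB
  have hmm : m * m ≤ 1 := mul_le_one' hm.le hm.le
  set G := reachVal F v B with hG
  have hGv : G ≤ v := by
    refine reachVal_le_weight ?_
    rintro s _ ⟨a, ha, rfl⟩
    simp only [Pi.smul_apply, smul_eq_mul, mul_assoc, ENNReal.tsum_mul_left]
    refine le_trans ?_ (hv s a ha)
    rw [← mul_assoc]
    exact mul_le_of_le_one_left' hmm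
  -- Of the two factors `m` in `B`, one pays for a choice that only nearly attains the supremum; the
  -- other remains as a genuine discount.
  have key : ∀ s, ∃ a ∈ A s, G s ≤ m * back F v a G := by
    intro s
    have : Nonempty (A s) := (hA s).to_subtype
    have hbound : ⨆ a : A s, back F v a G ≠ ⊤ := by
      refine ((iSup_le fun a => ?_).trans_lt (hv1 s).lt_top).ne
      exact (back_mono hGv).trans ((back_weight _).trans_le (hv s a a.2))
    obtain ⟨a, ha⟩ := exists_mul_iSup_le (fun a : A s => back F v a G) hbound hm
    refine ⟨a, a.2, ?_⟩
    rw [hG, reachVal_eq s, ← hG]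
    refine iSup₂_le ?_
    rintro _ ⟨b, hb, rfl⟩
    rw [back_smul, mul_assoc]
    gcongr
    refine le_trans ?_ ha
    gcongr
    exact le_iSup (fun a : A s => back F v a G) ⟨b, hb⟩
  choose c hc hcG using key
  refine ⟨c, hc, ?_⟩
  set r := reachVal F v fun s => {c s} with hr
  -- The remaining discount bounds what is still uncollected after `n` steps by `m ^ n * v s`, which
  -- vanishes because `v s` is finite.
  have hind : ∀ n s, G s ≤ r s + m ^ n * v s := by
    intro n
    induction n with
    | zero => intro s; simpa using (hGv s).trans le_add_self
    | succ n ih =>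
      intro s
      calc G s ≤ m * back F v (c s) G := hcG s
        _ ≤ m * (back F v (c s) r + ∑' t, c s t * (m ^ n * v t)) := by
            gcongr
            exact (back_mono ih).trans (back_add_le _ _ _)
        _ ≤ m * (r s + m ^ n * v s) := by
            gcongr
            · exact (reachVal_singleton c s).ge
            · simp only [mul_left_comm _ (m ^ n), ENNReal.tsum_mul_left]
              gcongr
              exact hv s _ (hc s)
        _ ≤ r s + m ^ (n + 1) * v s := by
            rw [mul_add, pow_succ', mul_assoc]
            gcongr
            exact mul_le_of_le_one_left' hm.le
  intro s
  have hlim : Tendsto (fun n => r s + m ^ n * v s) atTop (nhds (r s + 0 * v s)) :=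
    (ENNReal.Tendsto.mul_const (ENNReal.tendsto_pow_atTop_nhds_zero_of_lt_one hm)
      (Or.inr (hv1 s))).const_add _
  simpa using ge_of_tendsto' hlim fun n => hind n s

/-- From a fixed state, positional choices come arbitrarily close to the value. -/
theorem exists_choice_lt (hA : ∀ s, (A s).Nonempty)
    (hv : ∀ s, ∀ a ∈ A s, ∑' t, a t * v t ≤ v s) (hv1 : ∀ s, v s ≠ ⊤) {s : S} {x : ℝ≥0∞}
    (hx : x < reachVal F v A s) :
    ∃ c : S → S → ℝ≥0∞, (∀ s, c s ∈ A s) ∧ x < reachVal F v (fun s => {c s}) s := by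
  obtain ⟨n, hn⟩ := lt_iSup_iff.1 hx
  have hfin : iter F v A n s ≠ ⊤ :=
    (((le_iSup (fun n => iter F v A n s) n).trans (reachVal_le_weight hv s)).trans_lt
      (hv1 s).lt_top).ne
  have hcont : Tendsto (fun m : ℝ≥0∞ => (m * m) ^ n * iter F v A n s) (nhdsWithin 1 (Set.Iio 1))
      (nhds ((1 * 1) ^ n * iter F v A n s)) := by
    refine Tendsto.mono_left ?_ nhdsWithin_le_nhds
    refine ENNReal.Tendsto.mul_const (ENNReal.Tendsto.pow ?_) (Or.inr hfin)
    exact ENNReal.Tendsto.mul tendsto_id (by simp) tendsto_id (by simp)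
  have : (nhdsWithin (1 : ℝ≥0∞) (Set.Iio 1)).NeBot := nhdsLT_neBot_of_exists_lt ⟨0, zero_lt_one⟩
  obtain ⟨m, hxm, hm⟩ := ((hcont.eventually_const_lt (by simpa using hn)).and
    self_mem_nhdsWithin).exists
  obtain ⟨c, hc, hle⟩ := exists_choice_ge_discounted (F := F) hA hv hv1 hm
  refine ⟨c, hc, hxm.trans_le (le_trans ?_ (hle s))⟩
  have hm1 : m * m ≤ 1 := mul_le_one' (le_of_lt hm) (le_of_lt hm)
  -- Within a fixed horizon, discounting costs at most one factor per step, hence little for `m`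
  -- near 1.
  have hstep : ∀ k s, (m * m) ^ k * iter F v A k s ≤
      iter F v (fun s => (fun a => (m * m) • a) '' A s) k s := by
    intro k
    induction k with
    | zero => simp [iter]
    | succ k ih =>
      intro s
      simp only [iter, ENNReal.mul_iSup]
      refine iSup₂_le fun a ha => le_iSup₂_of_le _ ⟨a, ha, rfl⟩ ?_
      rw [back_smul, pow_succ', mul_assoc]
      gcongr
      exact (mul_back_le (pow_le_one' hm1 k) _ _).trans (back_mono ih)
  exact (hstep n s).trans (le_iSup (fun n => iter F v _ n s) n)

/-- Fixing the choice in some states, such that little value is lost everywhere and a good value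
from a given state `s₀` is guaranteed. -/
theorem exists_restriction (hA : ∀ s, (A s).Nonempty)
    (hv : ∀ s, ∀ a ∈ A s, ∑' t, a t * v t ≤ v s) (hv1 : ∀ s, v s ≠ ⊤) (s₀ : S) {θ : ℝ≥0∞}
    (hθ : θ < 1) :
    ∃ B : S → Set (S → ℝ≥0∞), (∀ s, (B s).Nonempty ∧ B s ⊆ A s ∧ (B s = A s ∨ ∃ a, B s = {a})) ∧
      (∀ s, θ * reachVal F v A s ≤ reachVal F v B s) ∧
      ∀ c : S → S → ℝ≥0∞, (∀ s, c s ∈ B s) →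
        θ * reachVal F v A s₀ ≤ reachVal F v (fun s => {c s}) s₀ := by
  classical
  set g := reachVal F v A with hg
  have hgtop : ∀ s, g s ≠ ⊤ := fun s =>
    ((reachVal_le_weight hv s).trans_lt (hv1 s).lt_top).ne
  have hθtop : θ ≠ ⊤ := (hθ.trans ENNReal.one_lt_top).ne
  have hθsum : θ + (1 - θ) = 1 := add_tsub_cancel_of_le hθ.le
  -- The constant is below 1, and subtracting `θ` and dividing by `1 - θ` leaves exactly `θ`.
  obtain ⟨c₀, hc₀, hc₀g⟩ : ∃ c : S → S → ℝ≥0∞, (∀ s, c s ∈ A s) ∧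
      (θ + (1 - θ) * θ) * g s₀ ≤ reachVal F v (fun s => {c s}) s₀ := by
    by_cases h0 : g s₀ = 0
    · choose c hc using hA
      exact ⟨c, hc, by simp [h0]⟩
    · have hlt : (θ + (1 - θ) * θ) * g s₀ < g s₀ := by
        conv_rhs => rw [← one_mul (g s₀)]
        refine ENNReal.mul_lt_mul_left h0 (hgtop _) ?_
        conv_rhs => rw [← hθsum]
        refine ENNReal.add_lt_add_left hθtop ?_
        conv_rhs => rw [← mul_one (1 - θ)]
        exact ENNReal.mul_lt_mul_right (tsub_pos_of_lt hθ).ne' (by finiteness) hθ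
      obtain ⟨c, hc, h⟩ := exists_choice_lt hA hv hv1 hlt
      exact ⟨c, hc, h.le⟩
  set r := reachVal F v (fun s => {c₀ s}) with hr
  refine ⟨fun s => if θ * g s ≤ r s then {c₀ s} else A s, fun s => ?_, ?_, fun c hc => ?_⟩
  · dsimp only
    split_ifs
    · exact ⟨Set.singleton_nonempty _, Set.singleton_subset_iff.2 (hc₀ s), Or.inr ⟨_, rfl⟩⟩
    · exact ⟨hA s, subset_rfl, Or.inl rfl⟩
  · set B : S → Set (S → ℝ≥0∞) := fun s => if θ * g s ≤ r s then {c₀ s} else A s with hB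
    have hrB : r ≤ reachVal F v B := by
      refine reachVal_mono fun s => Set.singleton_subset_iff.2 ?_
      simp only [hB]
      split_ifs
      exacts [rfl, hc₀ s]
    -- Where the choice was fixed, `c₀` itself guarantees the bound; elsewhere all of `A s` is still
    -- available.
    have : ∀ n s, θ * iter F v A n s ≤ reachVal F v B s := by
      intro n
      induction n with
      | zero => simp [iter]
      | succ n ih =>
        intro s
        by_cases hs : θ * g s ≤ r s
        · refine le_trans ?_ (hs.trans (hrB s))
          gcongr
          exact le_iSup (fun n => iter F v A n s) _
        · simp only [iter, ENNReal.mul_iSup]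
          refine iSup₂_le fun a ha => ?_
          refine ((mul_back_le hθ.le _ _).trans (back_mono ih)).trans (back_le_reachVal ?_)
          simpa only [hB, if_neg hs] using ha
    intro s
    rw [hg, reachVal, ENNReal.mul_iSup]
    exact iSup_le fun n => this n s
  · set f := reachVal F v fun s => {c s} with hf
    -- While `c₀` is fixed, `c` agrees with it and the convex combination propagates; at a state
    -- left free, `c₀` is worth less than `θ * g s` anyway.
    have key : ∀ n s, iter F v (fun s => {c₀ s}) n s ≤ θ * g s + (1 - θ) * f s := by
      intro n
      induction n with
      | zero => simp [iter]
      | succ n ih =>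
        intro s
        by_cases hs : θ * g s ≤ r s
        · have hcs : c s = c₀ s := by simpa [if_pos hs] using hc s
          simp only [iter, Set.mem_singleton_iff, iSup_iSup_eq_left]
          refine (back_mono ih).trans ?_
          rw [back_convex hθsum]
          gcongr
          · exact back_le_reachVal (hc₀ s)
          · rw [← hcs]
            exact (reachVal_singleton c s).ge
        · refine le_add_right (le_trans ?_ (not_le.1 hs).le)
          exact le_iSup (fun n => iter F v (fun s => {c₀ s}) n s) _
    have hfin : (θ + (1 - θ) * θ) * g s₀ ≤ θ * g s₀ + (1 - θ) * f s₀ :=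
      hc₀g.trans (iSup_le fun n => key n s₀)
    rw [add_mul, mul_assoc] at hfin
    have h1 := (ENNReal.add_le_add_iff_left (ENNReal.mul_ne_top hθtop (hgtop s₀))).1 hfin
    exact (ENNReal.mul_le_mul_iff_right (tsub_pos_of_lt hθ).ne' (by finiteness)).1 h1

end WeightedReach
end

/-! ### Weighted reachability: one positional choice for all states -/

noncomputable section

namespace WeightedReach

open scoped ENNReal

variable {S : Type*} {F : Set S} {v : S → ℝ≥0∞} {A : S → Set (S → ℝ≥0∞)}

/-- Either some set is a singleton, whose point survives forever, or the sequence never changes.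
This extracts a limit choice from the successive restrictions. -/
theorem exists_mem_iInter_of_singleton {α : Type*} {B : ℕ → Set α} (hB : ∀ k, (B k).Nonempty)
    (hanti : Antitone B) (hstep : ∀ k, B (k + 1) = B k ∨ ∃ a, B (k + 1) = {a}) :
    ∃ a, ∀ k, a ∈ B k := by
  by_cases h : ∃ k a, B k = {a}
  · obtain ⟨k, a, hk⟩ := h
    refine ⟨a, fun j => ?_⟩
    rcases le_total j k with hjk | hjk
    · exact hanti hjk (hk ▸ rfl)
    · obtain ⟨b, hb⟩ := hB j
      have : b = a := by simpa [hk] using hanti hjk hb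
      exact this ▸ hb
  · push Not at h
    have hconst : ∀ k, B k = B 0 := by
      intro k
      induction k with
      | zero => rfl
      | succ k ih =>
        rcases hstep k with hk | ⟨a, ha⟩
        · rw [hk, ih]
        · exact absurd ha (h _ _)
    obtain ⟨a, ha⟩ := hB 0
    exact ⟨a, fun k => hconst k ▸ ha⟩

/-- Infinitely many genuine losses `θ k` whose partial products `β k` telescope and decrease only to
one half. -/
theorem exists_factors : ∃ θ β : ℕ → ℝ≥0∞, (∀ k, θ k < 1) ∧ β 0 = 1 ∧ (∀ k, 2⁻¹ ≤ β k) ∧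
    ∀ k, θ k * β k = β (k + 1) := by
  have hne : ∀ k : ℕ, (2⁻¹ : ℝ≥0∞) + 2⁻¹ ^ (k + 1) ≠ 0 := fun k => by simp
  have hnt : ∀ k : ℕ, (2⁻¹ : ℝ≥0∞) + 2⁻¹ ^ (k + 1) ≠ ⊤ := fun k => by finiteness
  refine ⟨fun k => (2⁻¹ + 2⁻¹ ^ (k + 2)) / (2⁻¹ + 2⁻¹ ^ (k + 1)), fun k => 2⁻¹ + 2⁻¹ ^ (k + 1),
    fun k => ?_, ?_, fun k => le_self_add, fun k => ENNReal.div_mul_cancel (hne k) (hnt k)⟩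
  · rw [ENNReal.div_lt_iff (Or.inl (hne k)) (Or.inl (hnt k)), one_mul]
    refine ENNReal.add_lt_add_left (by finiteness) ?_
    rw [pow_succ]
    conv_rhs => rw [← mul_one (2⁻¹ ^ (k + 1))]
    exact ENNReal.mul_lt_mul_right (by simp) (by finiteness) (by simp)
  · simp [ENNReal.inv_two_add_inv_two]

/-- A positional choice that attains half of the value from every state. -/
theorem exists_choice_half [Countable S] (hA : ∀ s, (A s).Nonempty)
    (hv : ∀ s, ∀ a ∈ A s, ∑' t, a t * v t ≤ v s) (hv1 : ∀ s, v s ≠ ⊤) :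
    ∃ c : S → S → ℝ≥0∞, (∀ s, c s ∈ A s) ∧
      ∀ s, 2⁻¹ * reachVal F v A s ≤ reachVal F v (fun s => {c s}) s := by
  cases isEmpty_or_nonempty S
  · exact ⟨isEmptyElim, isEmptyElim, isEmptyElim⟩
  obtain ⟨e, he⟩ := exists_surjective_nat S
  obtain ⟨θ, β, hθ, hβ0, hβ, hθβ⟩ := exists_factors
  let T := {B : S → Set (S → ℝ≥0∞) // ∀ s, (B s).Nonempty ∧ B s ⊆ A s}
  have hstep : ∀ (k : ℕ) (B : T), ∃ C : T,
      (∀ s, C.1 s ⊆ B.1 s ∧ (C.1 s = B.1 s ∨ ∃ a, C.1 s = {a})) ∧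
      (∀ s, θ k * reachVal F v B.1 s ≤ reachVal F v C.1 s) ∧
      ∀ c : S → S → ℝ≥0∞, (∀ s, c s ∈ C.1 s) →
        θ k * reachVal F v B.1 (e k) ≤ reachVal F v (fun s => {c s}) (e k) := by
    intro k B
    obtain ⟨C, hC, hC1, hC2⟩ := exists_restriction (F := F) (fun s => (B.2 s).1)
      (fun s a ha => hv s a ((B.2 s).2 ha)) hv1 (e k) (hθ k)
    exact ⟨⟨C, fun s => ⟨(hC s).1, (hC s).2.1.trans (B.2 s).2⟩⟩, fun s => (hC s).2, hC1, hC2⟩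
  choose next hnext hval hgood using hstep
  let B : ℕ → T := fun k => Nat.rec ⟨A, fun s => ⟨hA s, subset_rfl⟩⟩ next k
  have hBval : ∀ k s, β k * reachVal F v A s ≤ reachVal F v (B k).1 s := by
    intro k
    induction k with
    | zero => intro s; simp [B, hβ0]
    | succ k ih =>
      intro s
      refine le_trans ?_ (hval k (B k) s)
      rw [← hθβ, mul_assoc]
      gcongr
      exact ih s
  have hex : ∀ s, ∃ a, ∀ k, a ∈ (B k).1 s := fun s =>
    exists_mem_iInter_of_singleton (fun k => ((B k).2 s).1)
      (antitone_nat_of_succ_le fun k => (hnext k (B k) s).1) fun k => (hnext k (B k) s).2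
  choose c hc using hex
  refine ⟨c, fun s => hc s 0, fun s => ?_⟩
  obtain ⟨k, rfl⟩ := he s
  -- The limit choice obeys every restriction, so the guarantee obtained for `e k` at stage `k`
  -- applies to it.
  refine le_trans ?_ (hgood k (B k) c fun s => hc s (k + 1))
  calc 2⁻¹ * reachVal F v A (e k) ≤ β (k + 1) * reachVal F v A (e k) := by gcongr; exact hβ _
    _ ≤ θ k * reachVal F v (B k).1 (e k) := by
      rw [← hθβ, mul_assoc]
      gcongr
      exact hBval k _

/-- A zero-one law: a positional choice which attains half of a harmonic weight from every state
attains all of it. -/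
theorem weight_le_reachVal_of_half {c : S → S → ℝ≥0∞} (hc : ∀ s, ∑' t, c s t * v t = v s)
    (hv1 : ∀ s, v s ≠ ⊤) (h : ∀ s, 2⁻¹ * v s ≤ reachVal F v (fun s => {c s}) s) :
    v ≤ reachVal F v fun s => {c s} := by
  set r := reachVal F v fun s => {c s} with hr
  have hvb : ∀ s, back F v (c s) v = v s := fun s => (back_weight _).trans (hc s)
  -- Without subtraction, this says `v - r ≤ (v - iter n) / 2`: the deficit sits on plays that avoid
  -- `F` for `n` steps, and there at most half of the weight is lost afterwards. As `n` grows, `iter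
  -- n` tends to `r`, so the deficit is at most half of itself.
  have key : ∀ n s, v s + 2⁻¹ * iter F v (fun s => {c s}) n s ≤ r s + 2⁻¹ * v s := by
    intro n
    induction n with
    | zero =>
      intro s
      calc v s + 2⁻¹ * iter F v (fun s => {c s}) 0 s = 2⁻¹ * v s + 2⁻¹ * v s := by
            rw [← add_mul, ENNReal.inv_two_add_inv_two]
            simp [iter]
        _ ≤ _ := by gcongr; exact h s
    | succ n ih =>
      intro s
      have hsum : back F v (c s) v + 2⁻¹ * back F v (c s) (iter F v (fun s => {c s}) n) ≤
          back F v (c s) r + 2⁻¹ * back F v (c s) v := by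
        simp only [back, ← ENNReal.tsum_mul_left, ← ENNReal.tsum_add]
        refine ENNReal.tsum_le_tsum fun t => ?_
        rw [mul_left_comm, ← mul_add, mul_left_comm, ← mul_add]
        refine mul_le_mul_right ?_ _
        split_ifs
        exacts [le_rfl, ih t]
      simpa only [iter, Set.mem_singleton_iff, iSup_iSup_eq_left, hvb,
        ← reachVal_singleton c s, hr] using hsum
  intro s
  have hlim : v s + 2⁻¹ * r s ≤ r s + 2⁻¹ * v s := by
    rw [hr, reachVal, ENNReal.mul_iSup, ENNReal.add_iSup]
    exact iSup_le fun n => key n s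
  have hrtop : r s ≠ ⊤ :=
    ((reachVal_le_weight (fun s a ha => by rw [Set.mem_singleton_iff.1 ha, hc]) s).trans_lt
      (hv1 s).lt_top).ne
  have e1 : v s + 2⁻¹ * r s = (2⁻¹ * r s + 2⁻¹ * v s) + 2⁻¹ * v s := by
    rw [add_assoc, ← add_mul, ENNReal.inv_two_add_inv_two, one_mul, add_comm]
  have e2 : r s + 2⁻¹ * v s = (2⁻¹ * r s + 2⁻¹ * v s) + 2⁻¹ * r s := by
    rw [add_right_comm, ← add_mul, ENNReal.inv_two_add_inv_two, one_mul]
  rw [e1, e2, ENNReal.add_le_add_iff_left (by finiteness [hv1 s])] at hlim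
  exact (ENNReal.mul_le_mul_iff_right (by simp) (by simp)).1 hlim

/-- If the weight `v` is harmonic for all available kernels and is the optimal value of reaching
`F`, then some positional choice attains it from every state. -/
theorem exists_choice_weight_le [Countable S] (hA : ∀ s, (A s).Nonempty)
    (hv : ∀ s, ∀ a ∈ A s, ∑' t, a t * v t = v s) (hv1 : ∀ s, v s ≠ ⊤)
    (hval : v ≤ reachVal F v A) :
    ∃ c : S → S → ℝ≥0∞, (∀ s, c s ∈ A s) ∧ v ≤ reachVal F v fun s => {c s} := by
  obtain ⟨c, hc, h⟩ := exists_choice_half (F := F) hA (fun s a ha => (hv s a ha).le) hv1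
  refine ⟨c, hc, weight_le_reachVal_of_half (fun s => hv s _ (hc s)) hv1 fun s => ?_⟩
  refine le_trans ?_ (h s)
  gcongr
  exact hval s

end WeightedReach
end

/-! ### Play measures: cylinders and first-step decomposition -/

noncomputable section

namespace MDP

variable {S : Type*} {M : MDP S}

/-- The sequence `s, w 0, w 1, …`. -/
def consSeq (s : S) (w : ℕ → S) : ℕ → S
  | 0 => s
  | n + 1 => w n

/-- The sequences which agree with `x` up to time `n`. -/
def cyl (x : ℕ → S) (n : ℕ) : Set (ℕ → S) := {w | ∀ i ≤ n, w i = x i}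

theorem consSeq_preimage_cyl_zero (s : S) (x : ℕ → S) :
    consSeq s ⁻¹' cyl x 0 = {_w | s = x 0} := by
  ext w
  simp [cyl, consSeq]

theorem consSeq_preimage_cyl_succ {s : S} {x : ℕ → S} (hs : s = x 0) (n : ℕ) :
    consSeq s ⁻¹' cyl x (n + 1) = cyl (fun i => x (i + 1)) n := by
  ext w
  refine ⟨fun h i hi => h (i + 1) (by lia), fun h i hi => ?_⟩
  cases i with
  | zero => exact hs
  | succ i => exact h i (by lia)

theorem cyl_anti (x : ℕ → S) : Antitone (cyl x) :=
  fun _ _ hmn _ hw i hi => hw i (hi.trans hmn)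

namespace Strategy

/-- The strategy that behaves like `σ` does after a first state `s`. -/
def tail (σ : M.Strategy) (s : S) : M.Strategy where
  act h x := σ.act (s :: h) x
  trans_of_mem_support h x := σ.trans_of_mem_support (s :: h) x

/-- Play the first step according to `σ`; then, from the state `t` that is reached, play according
to `τ t`. -/
def glue (σ : M.Strategy) (τ : S → M.Strategy) : M.Strategy where
  act h x := match h with
    | [] => σ.act [] x
    -- After one step, the state reached is the current state `x`, not yet part of the history.
    | _ :: [] => (τ x).act [] x
    | _ :: t :: h => (τ t).act (t :: h) x
  trans_of_mem_support h x := match h with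
    | [] => σ.trans_of_mem_support [] x
    | _ :: [] => (τ x).trans_of_mem_support [] x
    | _ :: t :: h => (τ t).trans_of_mem_support (t :: h) x

/-- The memoryless deterministic strategy that moves from `s` to `f s`. -/
def positional (f : S → S) (hf : ∀ s, M.trans s (f s)) : M.Strategy where
  act _ s := PMF.pure (f s)
  trans_of_mem_support _ s t ht := by
    rw [PMF.support_pure, Set.mem_singleton_iff] at ht
    exact ht ▸ hf s

theorem isMD_positional (f : S → S) (hf : ∀ s, M.trans s (f s)) : (positional f hf).IsMD :=
  ⟨fun _ _ _ => rfl, fun _ s => ⟨f s, rfl⟩⟩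

theorem tail_positional (f : S → S) (hf : ∀ s, M.trans s (f s)) (s : S) :
    (positional f hf).tail s = positional f hf := rfl

instance : Nonempty M.Strategy :=
  ⟨positional (fun s => (M.exists_trans s).choose) fun s => (M.exists_trans s).choose_spec⟩

theorem step_of_mem (σ : M.Strategy) (h : List S) {s : S} (hs : s ∈ M.player) :
    σ.step h s = σ.act h ⟨s, hs⟩ := dif_pos hs

theorem step_of_notMem (σ : M.Strategy) (h : List S) {s : S} (hs : s ∉ M.player) :
    σ.step h s = M.prob ⟨s, hs⟩ := dif_neg hs

theorem step_tail (σ : M.Strategy) (s : S) (h : List S) (x : S) :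
    (σ.tail s).step h x = σ.step (s :: h) x := rfl

theorem step_glue_nil (σ : M.Strategy) (τ : S → M.Strategy) (s : S) :
    (σ.glue τ).step [] s = σ.step [] s := rfl

theorem trans_of_mem_support_step (σ : M.Strategy) {h : List S} {s t : S}
    (ht : t ∈ (σ.step h s).support) : M.trans s t := by
  unfold step at ht
  split_ifs at ht
  exacts [σ.trans_of_mem_support _ _ t ht, M.trans_of_mem_support _ t ht]

theorem measurable_consSeq [MeasurableSpace S] (s : S) : Measurable (consSeq s) := by
  refine measurable_pi_iff.2 fun i => ?_
  cases i with
  | zero => exact measurable_const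
  | succ i => exact measurable_pi_apply i

theorem cyl_eq_preimage (x : ℕ → S) (n : ℕ) :
    cyl x n = (Preorder.frestrictLe (π := fun _ => S) n) ⁻¹' {Preorder.frestrictLe n x} := by
  ext w
  simp [cyl, funext_iff]

variable [Countable S] [MeasurableSpace S] [DiscreteMeasurableSpace S]

theorem measurableSet_cyl (x : ℕ → S) (n : ℕ) : MeasurableSet (cyl x n) := by
  rw [cyl_eq_preimage]
  exact Preorder.measurable_frestrictLe n (MeasurableSet.singleton _)

/-- Finite measures on sequences are determined by their values on cylinders. -/
theorem measure_ext_of_cyl {μ ν : Measure (ℕ → S)} [IsFiniteMeasure μ]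
    (h : ∀ x n, μ (cyl x n) = ν (cyl x n)) : μ = ν := by
  have hmap : ∀ n, μ.map (Preorder.frestrictLe (π := fun _ => S) n) =
      ν.map (Preorder.frestrictLe (π := fun _ => S) n) := by
    intro n
    refine Measure.ext_of_singleton fun y => ?_
    rw [Measure.map_apply (Preorder.measurable_frestrictLe n) (MeasurableSet.singleton _),
      Measure.map_apply (Preorder.measurable_frestrictLe n) (MeasurableSet.singleton _)]
    -- Freezing `y` after time `n` extends it to an infinite sequence, so its singleton becomes a
    -- cylinder.
    have hy : y = Preorder.frestrictLe (π := fun _ => S) n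
        (fun i => y ⟨min i n, Finset.mem_Iic.2 (min_le_right _ _)⟩) := by
      funext i
      simp only [Preorder.frestrictLe_apply]
      congr 1
      exact Subtype.ext (min_eq_left (Finset.mem_Iic.1 i.2)).symm
    rw [hy, ← cyl_eq_preimage, h]
  refine IsProjectiveLimit.unique (P := fun I => μ.map I.restrict) (fun I => rfl) fun I => ?_
  have hI := I.subset_Iic_sup_id
  have hcomp : I.restrict = Finset.restrict₂ (π := fun _ => S) hI ∘
      Preorder.frestrictLe (π := fun _ => S) (I.sup id) := rfl
  rw [hcomp, ← Measure.map_map (by fun_prop) (by fun_prop), ← hmap,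
    Measure.map_map (by fun_prop) (by fun_prop)]
  rfl

instance (σ : M.Strategy) (s : S) : IsProbabilityMeasure (σ.playMeasure s) := by
  unfold playMeasure
  infer_instance

open Classical in
theorem playMeasure_cyl_zero (σ : M.Strategy) (s : S) (x : ℕ → S) :
    σ.playMeasure s (cyl x 0) = if s = x 0 then 1 else 0 := by
  rw [cyl_eq_preimage, ← Measure.map_apply (Preorder.measurable_frestrictLe 0)
    (MeasurableSet.singleton _), playMeasure, Kernel.traj_map_frestrictLe_apply,
    Kernel.partialTraj_self, Kernel.id_apply, Measure.dirac_apply' _ (MeasurableSet.singleton _)]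
  have : (fun _ => s) ∈ ({Preorder.frestrictLe (π := fun _ => S) 0 x} : Set (Finset.Iic 0 → S)) ↔
      s = x 0 := by
    simp [funext_iff]
  simp only [Set.indicator_apply, this, Pi.one_apply]

theorem playMeasure_cyl_succ (σ : M.Strategy) (s : S) (x : ℕ → S) (n : ℕ) :
    σ.playMeasure s (cyl x (n + 1)) = σ.playMeasure s (cyl x n) *
      σ.step (List.ofFn fun i : Fin n => x i) (x n) (x (n + 1)) := by
  have h := Kernel.partialTraj_compProd_eq_map_traj (X := fun _ => S)
    (κ := fun n => σ.stepKernel n) (zero_le (a := n)) (x₀ := fun _ => s)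
  have hset := congrArg (fun μ : Measure ((Finset.Iic n → S) × S) =>
    μ ({Preorder.frestrictLe (π := fun _ => S) n x} ×ˢ {x (n + 1)})) h
  rw [Measure.compProd_apply_prod (MeasurableSet.singleton _) (MeasurableSet.singleton _),
    lintegral_singleton, ← Kernel.traj_map_frestrictLe_apply,
    Measure.map_apply (Preorder.measurable_frestrictLe n) (MeasurableSet.singleton _),
    ← cyl_eq_preimage, Measure.map_apply (by fun_prop)
      ((MeasurableSet.singleton _).prod (MeasurableSet.singleton _))] at hset
  have hcyl : (fun w : ℕ → S => (Preorder.frestrictLe (π := fun _ => S) n w, w (n + 1))) ⁻¹'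
      ({Preorder.frestrictLe (π := fun _ => S) n x} ×ˢ {x (n + 1)}) = cyl x (n + 1) := by
    ext w
    simp only [Set.mem_preimage, Set.mem_prod, Set.mem_singleton_iff, cyl, funext_iff,
      Set.mem_ofPred_eq, Preorder.frestrictLe_apply, Subtype.forall, Finset.mem_Iic]
    refine ⟨fun hw i hi => ?_, fun hw => ⟨fun i hi => hw i (by lia), hw _ le_rfl⟩⟩
    rcases Nat.le_succ_iff.1 hi with hi | rfl
    exacts [hw.1 i hi, hw.2]
  rw [hcyl] at hset
  rw [playMeasure, ← hset, mul_comm]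
  congr 1
  exact PMF.toMeasure_apply_singleton _ (x (n + 1)) (MeasurableSet.singleton _)

open Classical in
/-- The play measure is characterized by its values on cylinders. -/
theorem eq_playMeasure (σ : M.Strategy) (s : S) {μ : Measure (ℕ → S)}
    (h0 : ∀ x, μ (cyl x 0) = if s = x 0 then 1 else 0)
    (hsucc : ∀ x n, x 0 = s → μ (cyl x (n + 1)) = μ (cyl x n) *
      σ.step (List.ofFn fun i : Fin n => x i) (x n) (x (n + 1))) :
    σ.playMeasure s = μ := by
  refine measure_ext_of_cyl fun x n => ?_
  by_cases hx : x 0 = s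
  · induction n with
    | zero => rw [h0, playMeasure_cyl_zero]
    | succ n ih => rw [hsucc x n hx, playMeasure_cyl_succ, ih]
  · have hz : ∀ ν : Measure (ℕ → S), ν (cyl x 0) = (if s = x 0 then 1 else 0) →
        ν (cyl x n) = 0 := fun ν hν =>
      measure_mono_null (cyl_anti x (Nat.zero_le n)) (by rw [hν, if_neg (Ne.symm hx)])
    rw [hz _ (playMeasure_cyl_zero σ s x), hz _ (h0 x)]

/-- Cylinders not starting in `s` are null, so the strategies may differ on such histories. -/
theorem playMeasure_congr {σ τ : M.Strategy} {s : S}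
    (h : ∀ (x : ℕ → S) (n : ℕ), x 0 = s → σ.step (List.ofFn fun i : Fin n => x i) (x n) =
      τ.step (List.ofFn fun i : Fin n => x i) (x n)) :
    σ.playMeasure s = τ.playMeasure s :=
  eq_playMeasure σ s (playMeasure_cyl_zero τ s) fun x n hx => by
    rw [playMeasure_cyl_succ, h x n hx]

theorem playMeasure_glue_tail (σ : M.Strategy) (τ : S → M.Strategy) (s t : S) :
    ((σ.glue τ).tail s).playMeasure t = (τ t).playMeasure t := by
  refine playMeasure_congr fun x n hx => ?_
  subst hx
  cases n with
  | zero => rfl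
  | succ n => rw [List.ofFn_succ]; rfl

theorem playMeasure_eq_sum (σ : M.Strategy) (s : S) :
    σ.playMeasure s = Measure.sum fun t =>
      σ.step [] s t • ((σ.tail s).playMeasure t).map (consSeq s) := by
  classical
  have happly : ∀ x n, (Measure.sum fun t =>
      σ.step [] s t • ((σ.tail s).playMeasure t).map (consSeq s)) (cyl x n) =
      ∑' t, σ.step [] s t * (σ.tail s).playMeasure t (consSeq s ⁻¹' cyl x n) := by
    intro x n
    rw [Measure.sum_apply _ (measurableSet_cyl x n)]
    refine tsum_congr fun t => ?_
    rw [Measure.smul_apply, Measure.map_apply (measurable_consSeq s) (measurableSet_cyl x n),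
      smul_eq_mul]
  refine eq_playMeasure σ s (fun x => ?_) fun x n hx => ?_
  · rw [happly, consSeq_preimage_cyl_zero]
    split_ifs with hs
    · simp [hs, PMF.tsum_coe]
    · simp [hs]
  · rw [happly, happly, consSeq_preimage_cyl_succ hx.symm]
    -- The cylinder one step deep pins the summation index to `x 1`; for deeper ones the new factor
    -- is the same for all `t` and leaves the sum.
    cases n with
    | zero =>
      simp only [playMeasure_cyl_zero, consSeq_preimage_cyl_zero, hx, Set.ofPred_true, measure_univ,
        mul_one, PMF.tsum_coe, one_mul, List.ofFn_zero, zero_add]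
      rw [tsum_eq_single (x 1) (fun t ht => by rw [if_neg ht, mul_zero]), if_pos rfl, mul_one]
    | succ n =>
      simp only [consSeq_preimage_cyl_succ hx.symm, playMeasure_cyl_succ, ← mul_assoc,
        ENNReal.tsum_mul_right]
      rw [step_tail, List.ofFn_succ (n := n)]
      simp [hx]

/-- The first-step decomposition of the play measure. -/
theorem playMeasure_apply (σ : M.Strategy) (s : S) {E : Set (ℕ → S)} (hE : MeasurableSet E) :
    σ.playMeasure s E =
      ∑' t, σ.step [] s t * (σ.tail s).playMeasure t (consSeq s ⁻¹' E) := by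
  rw [playMeasure_eq_sum, Measure.sum_apply _ hE]
  refine tsum_congr fun t => ?_
  rw [Measure.smul_apply, Measure.map_apply (measurable_consSeq s) hE, smul_eq_mul]

end Strategy
end MDP
end

/-! ### Büchi objectives: optimal states, harmonic weight, positional strategy -/

noncomputable section

namespace MDP

open WeightedReach

variable {S : Type*} {M : MDP S}

theorem parityObjective_eq_of_isBuchiColoring {col : S → ℕ} (hcol : IsBuchiColoring col) :
    parityObjective col = {w | ∃ᶠ n in atTop, w n ∈ {s | col s = 2}} := by
  ext w
  constructor
  · rintro ⟨k, hk, hfreq, -⟩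
    refine hfreq.mono fun n hn => ?_
    rcases hcol (w n) with h | h
    · rw [← hn, h] at hk
      exact absurd hk (by decide)
    · exact h
  · intro h
    refine ⟨2, even_two, h, Eventually.of_forall fun n => ?_⟩
    rcases hcol (w n) with h | h <;> simp [Set.mem_singleton_iff.1 h]

/-- The sequences that visit `F` infinitely often. -/
def infOften (F : Set S) : Set (ℕ → S) := {w | ∃ᶠ n in atTop, w n ∈ F}

/-- The sequences that visit `F` at some time `≥ k`. -/
def visitsFrom (F : Set S) (k : ℕ) : Set (ℕ → S) := {w | ∃ n, k ≤ n ∧ w n ∈ F}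

/-- The sequences that visit `F` at some time in `[1, n]`. -/
def visitsWithin (F : Set S) (n : ℕ) : Set (ℕ → S) := {w | ∃ i, 1 ≤ i ∧ i ≤ n ∧ w i ∈ F}

variable {F : Set S}

theorem infOften_eq_iInter : infOften F = ⋂ k, visitsFrom F k := by
  ext w
  simp [infOften, visitsFrom, frequently_atTop]

theorem visitsFrom_anti : Antitone (visitsFrom F) :=
  fun _ _ hjk _ ⟨n, hn, hw⟩ => ⟨n, hjk.trans hn, hw⟩

theorem consSeq_preimage_visitsFrom_succ (s : S) (k : ℕ) :
    consSeq s ⁻¹' visitsFrom F (k + 1) = visitsFrom F k := by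
  ext w
  constructor
  · rintro ⟨n, hn, hw⟩
    obtain ⟨m, rfl⟩ := Nat.exists_eq_add_of_le' (show 1 ≤ n by lia)
    exact ⟨m, by lia, hw⟩
  · rintro ⟨n, hn, hw⟩
    exact ⟨n + 1, by lia, hw⟩

theorem consSeq_preimage_infOften (s : S) : consSeq s ⁻¹' infOften F = infOften F := by
  have h : infOften F = ⋂ k, visitsFrom F (k + 1) := by
    rw [infOften_eq_iInter]
    exact (visitsFrom_anti.iInter_nat_add 1).symm
  conv_lhs => rw [h]
  rw [Set.preimage_iInter, infOften_eq_iInter]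
  simp only [consSeq_preimage_visitsFrom_succ]

theorem visitsWithin_mono : Monotone (visitsWithin F) :=
  fun _ _ hjk _ ⟨i, hi, hin, hw⟩ => ⟨i, hi, hin.trans hjk, hw⟩

theorem infOften_subset_iUnion_visitsWithin : infOften F ⊆ ⋃ n, visitsWithin F n := by
  intro w hw
  obtain ⟨n, hn, hwn⟩ := (frequently_atTop.1 hw) 1
  exact Set.mem_iUnion.2 ⟨n, n, hn, le_rfl, hwn⟩

theorem consSeq_preimage_visitsWithin_succ {s : S} {n : ℕ} {w : ℕ → S}
    (h : consSeq s w ∈ visitsWithin F (n + 1)) : w 0 ∈ F ∨ w ∈ visitsWithin F n := by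
  obtain ⟨i, hi, hin, hw⟩ := h
  obtain ⟨j, rfl⟩ := Nat.exists_eq_add_of_le' hi
  cases j with
  | zero => exact Or.inl hw
  | succ j => exact Or.inr ⟨j + 1, by lia, by lia, hw⟩

/-- A strict gap at a point of positive mass would make the finite averages differ. -/
theorem eq_of_tsum_le_of_le {p : PMF S} {f g : S → ENNReal} (hfg : f ≤ g) (hg : ∑' t, p t * g t ≠ ⊤)
    (h : ∑' t, p t * g t ≤ ∑' t, p t * f t) {t : S} (ht : t ∈ p.support) : f t = g t := by
  by_contra hne
  have hlt : f t < g t := lt_of_le_of_ne (hfg t) hne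
  refine (ENNReal.tsum_lt_tsum (i := t) ?_ (fun x => mul_le_mul_right (hfg x) _) ?_).not_ge h
  · exact ((ENNReal.tsum_le_tsum fun x => mul_le_mul_right (hfg x) _).trans_lt hg.lt_top).ne
  · exact ENNReal.mul_lt_mul_right ((PMF.mem_support_iff _ _).1 ht) (p.apply_ne_top t) hlt

theorem tsum_pure_mul (t : S) (f : S → ENNReal) : ∑' x, PMF.pure t x * f x = f t := by
  classical
  simp [PMF.pure_apply]

variable [MeasurableSpace S] [DiscreteMeasurableSpace S]

theorem measurableSet_visitsFrom (k : ℕ) : MeasurableSet (visitsFrom F k) := by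
  have : visitsFrom F k = ⋃ n, ⋃ (_ : k ≤ n), (fun w : ℕ → S => w n) ⁻¹' F := by
    ext w
    simp [visitsFrom]
  rw [this]
  exact .iUnion fun n => .iUnion fun _ => measurable_pi_apply n (.of_discrete)

theorem measurableSet_visitsWithin (n : ℕ) : MeasurableSet (visitsWithin F n) := by
  have : visitsWithin F n = ⋃ i, ⋃ (_ : 1 ≤ i ∧ i ≤ n), (fun w : ℕ → S => w i) ⁻¹' F := by
    ext w
    simp [visitsWithin, and_assoc]
  rw [this]
  exact .iUnion fun n => .iUnion fun _ => measurable_pi_apply n (.of_discrete)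

theorem measurableSet_infOften : MeasurableSet (infOften F) := by
  rw [infOften_eq_iInter]
  exact .iInter measurableSet_visitsFrom

variable [Countable S]

namespace Strategy

theorem playMeasure_infOften (σ : M.Strategy) (s : S) :
    σ.playMeasure s (infOften F) =
      ∑' t, σ.step [] s t * (σ.tail s).playMeasure t (infOften F) := by
  simpa only [consSeq_preimage_infOften] using σ.playMeasure_apply s measurableSet_infOften

theorem playMeasure_start (σ : M.Strategy) (s : S) : ∀ᵐ w ∂σ.playMeasure s, w 0 = s := by
  have h : σ.playMeasure s (cyl (fun _ => s) 0) = 1 := by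
    rw [playMeasure_cyl_zero, if_pos rfl]
  have := (prob_compl_eq_zero_iff (measurableSet_cyl (fun _ => s) 0)).2 h
  refine measure_mono_null ?_ this
  intro w hw hc
  exact hw (hc 0 le_rfl)

end Strategy

theorem value_le_one (φ : Set (ℕ → S)) (s : S) : M.value φ s ≤ 1 :=
  iSup_le fun _ => prob_le_one

theorem value_ne_top (φ : Set (ℕ → S)) (s : S) : M.value φ s ≠ ⊤ :=
  ((value_le_one φ s).trans_lt ENNReal.one_lt_top).ne

theorem le_value (σ : M.Strategy) (φ : Set (ℕ → S)) (s : S) : σ.playMeasure s φ ≤ M.value φ s :=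
  le_iSup (fun σ : M.Strategy => σ.playMeasure s φ) σ

/-- After the first step of `σ`, continue from each `t` with a strategy within the factor `m` of the
value, and let `m` tend to 1. -/
theorem tsum_step_mul_value_le (σ : M.Strategy) (s : S) :
    ∑' t, σ.step [] s t * M.value (infOften F) t ≤ M.value (infOften F) s := by
  refine ENNReal.le_of_forall_lt_one_mul_le fun m hm => ?_
  choose τ hτ using fun t => exists_mul_iSup_le
    (fun σ : M.Strategy => σ.playMeasure t (infOften F)) (value_ne_top _ t) hm
  refine le_trans ?_ (le_value (σ.glue τ) _ s)
  rw [Strategy.playMeasure_infOften, ← ENNReal.tsum_mul_left]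
  refine ENNReal.tsum_le_tsum fun t => ?_
  rw [Strategy.step_glue_nil, Strategy.playMeasure_glue_tail, mul_left_comm]
  gcongr
  exact hτ t

theorem value_le_of_trans {s t : S} (hs : s ∈ M.player) (hst : M.trans s t) :
    M.value (infOften F) t ≤ M.value (infOften F) s := by
  classical
  choose f hf using M.exists_trans
  have h := tsum_step_mul_value_le (F := F) (Strategy.positional (Function.update f s t) fun x => by
    rcases eq_or_ne x s with rfl | hx
    · simpa using hst
    · simpa [hx] using hf x) s
  rw [Strategy.step_of_mem _ _ hs] at h
  simpa [Strategy.positional, PMF.pure_apply] using h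

/-- The states from which some strategy is optimal. -/
def optStates (M : MDP S) (F : Set S) : Set S :=
  {s | ∃ σ : M.Strategy, σ.IsOptimal (infOften F) s}

theorem tsum_step_mul_value_of_isOptimal {σ : M.Strategy} {s : S}
    (h : σ.IsOptimal (infOften F) s) :
    ∑' t, σ.step [] s t * M.value (infOften F) t = M.value (infOften F) s := by
  refine le_antisymm (tsum_step_mul_value_le σ s) (h.trans ?_)
  rw [Strategy.playMeasure_infOften]
  exact ENNReal.tsum_le_tsum fun t => mul_le_mul_right (le_value _ _ t) _

theorem isOptimal_tail {σ : M.Strategy} {s t : S} (h : σ.IsOptimal (infOften F) s)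
    (ht : t ∈ (σ.step [] s).support) : (σ.tail s).IsOptimal (infOften F) t := by
  refine (eq_of_tsum_le_of_le (f := fun t => (σ.tail s).playMeasure t (infOften F))
    (g := M.value (infOften F)) (fun t => le_value _ _ t) ?_ ?_ ht).ge
  · rw [tsum_step_mul_value_of_isOptimal h]
    exact value_ne_top _ _
  · rw [tsum_step_mul_value_of_isOptimal h, ← Strategy.playMeasure_infOften]
    exact h

/-- From a player state no successor has larger value, yet the average over the chosen ones equals
the value of `s`. -/
theorem value_eq_of_isOptimal {σ : M.Strategy} {s t : S} (h : σ.IsOptimal (infOften F) s)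
    (hs : s ∈ M.player) (ht : t ∈ (σ.step [] s).support) :
    M.value (infOften F) t = M.value (infOften F) s := by
  set p := σ.step [] s with hp
  have hconst : ∑' x, p x * M.value (infOften F) s = M.value (infOften F) s := by
    rw [ENNReal.tsum_mul_right, PMF.tsum_coe, one_mul]
  have hval : ∑' x, p x * M.value (infOften F) x = M.value (infOften F) s :=
    tsum_step_mul_value_of_isOptimal h
  by_contra hne
  have hle : ∀ x, p x * M.value (infOften F) x ≤ p x * M.value (infOften F) s := by
    intro x
    by_cases hx : p x = 0
    · simp [hx]
    · exact mul_le_mul_right (value_le_of_trans hs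
        (σ.trans_of_mem_support_step ((PMF.mem_support_iff _ _).2 hx))) _
  have hlt := lt_of_le_of_ne (value_le_of_trans (F := F) hs (σ.trans_of_mem_support_step ht)) hne
  refine (ENNReal.tsum_lt_tsum (i := t) ?_ hle ?_).ne (hval.trans hconst.symm)
  · rw [hval]
    exact value_ne_top _ _
  · exact ENNReal.mul_lt_mul_right ((PMF.mem_support_iff _ _).1 ht) (p.apply_ne_top t) hlt

open Classical in
/-- The value, restricted to the states from which some strategy is optimal. -/
def optWeight (M : MDP S) (F : Set S) (s : S) : ENNReal :=
  if s ∈ optStates M F then M.value (infOften F) s else 0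

/-- The available kernels in the states from which some strategy is optimal: a move of the player
must preserve the value and the existence of an optimal strategy. -/
def optKernels (M : MDP S) (F : Set S) (s : S) : Set (S → ENNReal) :=
  -- The zero kernel keeps the weight, which is 0 here, harmonic at every state.
  {a | (s ∉ optStates M F ∧ a = 0) ∨
    (s ∈ optStates M F ∧ ∃ hs : s ∉ M.player, a = M.prob ⟨s, hs⟩) ∨
    (s ∈ optStates M F ∧ s ∈ M.player ∧ ∃ t ∈ optStates M F, M.trans s t ∧
      M.value (infOften F) t = M.value (infOften F) s ∧ a = PMF.pure t)}

/-- At a random state every strategy makes the same first step, so all successors are reached by an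
optimal one. -/
theorem mem_optStates_of_mem_support_prob {s t : S} (h : s ∈ optStates M F) (hs : s ∉ M.player)
    (ht : t ∈ (M.prob ⟨s, hs⟩).support) : t ∈ optStates M F := by
  obtain ⟨σ, hσ⟩ := h
  exact ⟨_, isOptimal_tail hσ (by rwa [σ.step_of_notMem _ hs])⟩

theorem optKernels_nonempty (s : S) : (optKernels M F s).Nonempty := by
  by_cases h : s ∈ optStates M F
  · by_cases hs : s ∈ M.player
    · obtain ⟨σ, hσ⟩ := h
      obtain ⟨t, ht⟩ := (σ.step [] s).support_nonempty
      exact ⟨_, Or.inr (Or.inr ⟨⟨σ, hσ⟩, hs, t, ⟨_, isOptimal_tail hσ ht⟩,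
        σ.trans_of_mem_support_step ht, value_eq_of_isOptimal hσ hs ht, rfl⟩)⟩
    · exact ⟨_, Or.inr (Or.inl ⟨h, hs, rfl⟩)⟩
  · exact ⟨0, Or.inl ⟨h, rfl⟩⟩

theorem tsum_optKernels_mul_optWeight {s : S} {a : S → ENNReal} (ha : a ∈ optKernels M F s) :
    ∑' t, a t * optWeight M F t = optWeight M F s := by
  rcases ha with ⟨h, rfl⟩ | ⟨h, hs, rfl⟩ | ⟨h, hs, t, ht, -, hv, rfl⟩
  · simp [optWeight, h]
  · have hsum : ∑' t, M.prob ⟨s, hs⟩ t * optWeight M F t =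
        ∑' t, M.prob ⟨s, hs⟩ t * M.value (infOften F) t := by
      refine tsum_congr fun t => ?_
      by_cases ht : M.prob ⟨s, hs⟩ t = 0
      · simp [ht]
      · rw [optWeight, if_pos (mem_optStates_of_mem_support_prob h hs
          ((PMF.mem_support_iff _ _).2 ht))]
    rw [hsum, optWeight, if_pos h]
    obtain ⟨σ, hσ⟩ := h
    rw [← σ.step_of_notMem [] hs]
    exact tsum_step_mul_value_of_isOptimal hσ
  · rw [tsum_pure_mul, optWeight, optWeight, if_pos h, if_pos ht, hv]

theorem optWeight_ne_top (s : S) : optWeight M F s ≠ ⊤ := by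
  unfold optWeight
  split_ifs
  exacts [value_ne_top _ _, ENNReal.zero_ne_top]

/-- Along optimal strategies, the objective together with a visit to `F` within `n` steps is at
most as likely as the `n`-step value of reaching `F`. -/
theorem playMeasure_inter_le_iter (n : ℕ) : ∀ {s : S} {σ : M.Strategy},
    σ.IsOptimal (infOften F) s → σ.playMeasure s (infOften F ∩ visitsWithin F n) ≤
      iter F (optWeight M F) (optKernels M F) n s := by
  induction n with
  | zero =>
    intro s σ _
    have : visitsWithin F 0 = ∅ := by
      ext w
      simp only [visitsWithin, Set.mem_ofPred_eq, Set.mem_empty_iff_false, iff_false]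
      lia
    simp [this]
  | succ n ih =>
    intro s σ hσ
    have hsopt : s ∈ optStates M F := ⟨σ, hσ⟩
    have hstep : ∀ t ∈ (σ.step [] s).support, (σ.tail s).playMeasure t
        (consSeq s ⁻¹' (infOften F ∩ visitsWithin F (n + 1))) ≤
        open Classical in if t ∈ F then optWeight M F t else
          iter F (optWeight M F) (optKernels M F) n t := by
      intro t ht
      have hopt := isOptimal_tail hσ ht
      rw [Set.preimage_inter, consSeq_preimage_infOften]
      split_ifs with htF
      -- At a visit to `F` the play is cut off: later success is bounded by the value there.
      · rw [optWeight, if_pos ⟨_, hopt⟩]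
        exact (measure_mono Set.inter_subset_left).trans (le_value _ _ _)
      · refine le_trans (measure_mono_ae ?_) (ih hopt)
        filter_upwards [(σ.tail s).playMeasure_start t] with w hw0 hw
        refine ⟨hw.1, (consSeq_preimage_visitsWithin_succ hw.2).resolve_left ?_⟩
        rwa [hw0]
    rw [Strategy.playMeasure_apply _ _ (measurableSet_infOften.inter (measurableSet_visitsWithin _))]
    have hsum : ∑' t, σ.step [] s t * (σ.tail s).playMeasure t
        (consSeq s ⁻¹' (infOften F ∩ visitsWithin F (n + 1))) ≤
        back F (optWeight M F) (σ.step [] s) (iter F (optWeight M F) (optKernels M F) n) := by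
      refine ENNReal.tsum_le_tsum fun t => ?_
      by_cases ht : σ.step [] s t = 0
      · simp [ht]
      · exact mul_le_mul_right (hstep t ((PMF.mem_support_iff _ _).2 ht)) _
    refine hsum.trans ?_
    by_cases hs : s ∈ M.player
    -- A randomized move is a mixture of Dirac kernels that all lie in `optKernels`, so the supremum
    -- bounds each term.
    · rw [← one_mul (iter F (optWeight M F) (optKernels M F) (n + 1) s),
        ← PMF.tsum_coe (σ.step [] s), ← ENNReal.tsum_mul_right]
      refine ENNReal.tsum_le_tsum fun t => ?_
      by_cases ht : σ.step [] s t = 0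
      · simp [ht]
      · have ht' := (PMF.mem_support_iff _ _).2 ht
        refine mul_le_mul_right ?_ _
        refine le_iSup₂_of_le (PMF.pure t : S → ENNReal) (Or.inr (Or.inr ⟨hsopt, hs, t,
          ⟨_, isOptimal_tail hσ ht'⟩, σ.trans_of_mem_support_step ht',
          value_eq_of_isOptimal hσ hs ht', rfl⟩)) ?_
        rw [back, tsum_pure_mul]
    · rw [σ.step_of_notMem [] hs]
      exact le_iSup₂_of_le _ (Or.inr (Or.inl ⟨hsopt, hs, rfl⟩)) le_rfl

theorem optWeight_le_reachVal :
    optWeight M F ≤ reachVal F (optWeight M F) (optKernels M F) := by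
  intro s
  by_cases h : s ∈ optStates M F
  · obtain ⟨σ, hσ⟩ := h
    rw [optWeight, if_pos ⟨σ, hσ⟩]
    have hU : infOften F = ⋃ n, infOften F ∩ visitsWithin F n := by
      rw [← Set.inter_iUnion, Set.inter_eq_left.2 infOften_subset_iUnion_visitsWithin]
    refine hσ.trans ?_
    have hmono : Monotone fun n => infOften F ∩ visitsWithin F n :=
      fun m n hmn => Set.inter_subset_inter_right _ (visitsWithin_mono hmn)
    conv_lhs => rw [hU, hmono.measure_iUnion]
    exact iSup_mono fun n => playMeasure_inter_le_iter n hσ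
  · simp [optWeight, h]

/-- If the positional strategy `τ` makes the choice `c`, which attains the weight as the value of
reaching `F`, then `τ` visits `F` infinitely often with at least the probability given by the
weight. -/
theorem optWeight_le_playMeasure_positional {f : S → S} {hf : ∀ s, M.trans s (f s)}
    {c : S → S → ENNReal} (hc : ∀ s, c s ∈ optKernels M F s)
    (hcf : ∀ s ∈ optStates M F, c s = (Strategy.positional f hf).step [] s)
    (hcv : optWeight M F ≤ reachVal F (optWeight M F) fun s => {c s}) (s : S) :
    optWeight M F s ≤ (Strategy.positional f hf).playMeasure s (infOften F) := by
  set τ := Strategy.positional f hf with hτ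
  have hstep : ∀ (s : S) (k : ℕ), s ∈ optStates M F →
      τ.playMeasure s (visitsFrom F (k + 1)) =
        ∑' t, c s t * τ.playMeasure t (visitsFrom F k) := by
    intro s k hs
    rw [τ.playMeasure_apply s (measurableSet_visitsFrom _), consSeq_preimage_visitsFrom_succ,
      hcf s hs, hτ, Strategy.tail_positional]
  have hF : ∀ s ∈ F, τ.playMeasure s (visitsFrom F 0) = 1 := by
    intro s hs
    refine le_antisymm prob_le_one ?_
    rw [← measure_univ (μ := τ.playMeasure s)]
    refine measure_mono_ae ?_
    filter_upwards [τ.playMeasure_start s] with w hw _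
    exact ⟨0, le_rfl, hw ▸ hs⟩
  -- Each visit pays at most 1, so the collected weight is at most the probability of a visit.
  have hone : ∀ s, optWeight M F s ≤ τ.playMeasure s (visitsFrom F 1) := by
    refine fun s => (hcv s).trans (iSup_le fun n => ?_)
    induction n generalizing s with
    | zero => exact zero_le
    | succ n ih =>
      by_cases hs : s ∈ optStates M F
      · simp only [iter, Set.mem_singleton_iff, iSup_iSup_eq_left]
        rw [hstep s 0 hs]
        refine ENNReal.tsum_le_tsum fun t => mul_le_mul_right ?_ _
        split_ifs with ht
        · rw [hF t ht]
          unfold optWeight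
          split_ifs
          exacts [value_le_one _ _, zero_le]
        · exact (ih t).trans (measure_mono (visitsFrom_anti zero_le_one))
      · refine ((le_iSup (fun n => iter F _ (fun s => {c s}) n s) _).trans
          (reachVal_le_weight ?_ s)).trans ?_
        · rintro s a rfl
          exact (tsum_optKernels_mul_optWeight (hc s)).le
        · simp [optWeight, hs]
  -- Averaging the bound over the first step delays the visit by one time unit and, by harmonicity,
  -- reproduces the weight; no successive returns to `F` need be tracked.
  have hall : ∀ k s, optWeight M F s ≤ τ.playMeasure s (visitsFrom F (k + 1)) := by
    intro k
    induction k with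
    | zero => exact hone
    | succ k ih =>
      intro s
      by_cases hs : s ∈ optStates M F
      · rw [hstep s _ hs, ← tsum_optKernels_mul_optWeight (hc s)]
        exact ENNReal.tsum_le_tsum fun t => mul_le_mul_right (ih t) _
      · simp [optWeight, hs]
  rw [infOften_eq_iInter, visitsFrom_anti.measure_iInter
    (fun k => (measurableSet_visitsFrom k).nullMeasurableSet) ⟨0, measure_ne_top _ _⟩]
  exact le_iInf fun k => (hall k s).trans (measure_mono (visitsFrom_anti (Nat.le_succ k)))

theorem exists_positional_isOptimal (M : MDP S) (F : Set S) :
    ∃ τ : M.Strategy, τ.IsMD ∧ ∀ s ∈ optStates M F, τ.IsOptimal (infOften F) s := by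
  obtain ⟨c, hc, hcv⟩ := exists_choice_weight_le (F := F) (optKernels_nonempty (M := M) (F := F))
    (fun s a ha => tsum_optKernels_mul_optWeight ha) optWeight_ne_top optWeight_le_reachVal
  have hex : ∀ s, ∃ t, M.trans s t ∧
      (s ∈ optStates M F → s ∈ M.player → c s = (PMF.pure t : S → ENNReal)) := by
    intro s
    by_cases h : s ∈ optStates M F ∧ s ∈ M.player
    · rcases hc s with ⟨h', -⟩ | ⟨-, h', -⟩ | ⟨-, -, t, -, ht, -, hct⟩
      exacts [absurd h.1 h', absurd h.2 h', ⟨t, ht, fun _ _ => hct⟩]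
    · obtain ⟨t, ht⟩ := M.exists_trans s
      exact ⟨t, ht, fun h1 h2 => absurd ⟨h1, h2⟩ h⟩
  choose f hf hcf using hex
  refine ⟨Strategy.positional f hf, Strategy.isMD_positional f hf, fun s hs => ?_⟩
  have h := optWeight_le_playMeasure_positional (hf := hf) hc (fun s hs => ?_) hcv s
  · rwa [optWeight, if_pos hs] at h
  · by_cases hp : s ∈ M.player
    · rw [Strategy.step_of_mem _ _ hp, hcf s hs hp]
      rfl
    · rw [Strategy.step_of_notMem _ _ hp]
      rcases hc s with ⟨h', -⟩ | ⟨-, _, h'⟩ | ⟨-, h', -⟩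
      exacts [absurd hs h', h', absurd h' hp]

end MDP
end

/-- In every countable (possibly infinitely branching) MDP with a Büchi objective there is one
memoryless deterministic strategy that is optimal from every state from which some strategy is
optimal. -/
theorem mainTheorem5 {S : Type*} [Countable S] [MeasurableSpace S] [DiscreteMeasurableSpace S]
    (M : MDP S) (col : S → ℕ) (hcol : IsBuchiColoring col) :
    ∃ τ : M.Strategy, τ.IsMD ∧
      ∀ s : S, (∃ σ : M.Strategy, σ.IsOptimal (parityObjective col) s) →
        τ.IsOptimal (parityObjective col) s := by
  rw [MDP.parityObjective_eq_of_isBuchiColoring hcol]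
  exact M.exists_positional_isOptimal {s | col s = 2}
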